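/- Let $M$ be a finitely generated, left cancellative monoid of bounded indegree which is strongly hyperbolic. Then the $\mathcal{L}$-order and the $\mathcal{R}$-order of $M$ are both in $\mathcal{NP}$; that is, for every finite alphabet $A$ with a map $f\colon A\to M$ whose image generates $M$ (extended to words $A^*\to M$), the languages $\{u\#v : u,v\in A^*,\ Mf(u)\subseteq Mf(v)\}$ and $\{u\#v : u,v\in A^*,\ f(u)M\subseteq f(v)M\}$ over $A\sqcup\{\#\}$ are in $\mathcal{NP}$. Here $M$ has bounded indegree if, for some finite generating set $S$ (equivalently, for every one) and some $\alpha\in\mathbb{N}$, there are no $a\in S$ and distinct $x_0,\dots,x_\alpha\in M$ with $x_0a=\dots=x_\alpha a$. For a finite generating set $S$, the right Cayley graph is the directed graph with vertex set $M$ and edges $m\to ms$ ($m\in M$, $s\in S$); $d(x,y)\in\mathbb{N}\cup\{\infty\}$ denotes the length of a shortest directed path from $x$ to $y$, and a geodesic is a directed path whose length is the distance from its start to its end. A geodesic triangle $(p,q,r)$ consists of three geodesics such that $q$ starts where $p$ ends, $r$ starts where $p$ starts and $r$ ends where $q$ ends. It is $\delta$-thin if every vertex $v$ of $r$ satisfies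 $d(a,v)\le\delta$ for some vertex $a$ of $p$ or $d(v,b)\le\delta$ for some vertex $b$ of $q$; every vertex $v$ of $p$ satisfies $d(a,v)\le\delta$ for some $a$ on $r$ or $d(v,b)\le\delta$ for some $b$ on $q$; and every vertex $v$ of $q$ satisfies $d(a,v)\le\delta$ for some $a$ on $p$ or $d(v,b)\le\delta$ for some $b$ on $r$. The monoid $M$ is strongly hyperbolic if there are a finite generating set $S$ and a real $\delta\ge 0$ such that all geodesic triangles of the right Cayley graph with respect to $S$ are $\delta$-thin. A language $L$ over a finite alphabet is in $\mathcal{NP}$ if there are a nondeterministic Turing machine and a polynomial $P$ such that the machine accepts exactly the words of $L$, and every $x\in L$ has an accepting computation of at most $P(|x|)$ steps. -/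

import Mathlib

namespace HypMonoid

/-! Directed graphs as semimetric spaces. Multiplicities of edges play no role for the distance
or for paths (which are sequences of vertices), so `Digraph` is used. -/

section Graph

variable {V : Type*}

/-- A directed path `[x₀, …, xₙ]` (`n ≥ 0`) in `G`; its number `n` of edges is `p.length`,
its start is `p.head` and its end is `p.last`. -/
abbrev DiPath (G : Digraph V) : Type _ := RelSeries {e : V × V | G.Adj e.1 e.2}

/-- The length of a shortest directed path from `x` to `y`, and `⊤` if there is none. -/
noncomputable def dist (G : Digraph V) (x y : V) : ℕ∞ :=
  ⨅ p : {p : DiPath G // p.head = x ∧ p.last = y}, (p.1.length : ℕ∞)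

/-- The out-ball of radius `r` based at `x`. -/
def outBall (G : Digraph V) (r : NNReal) (x : V) : Set V :=
  {y | ((dist G x y : ℕ∞) : ENNReal) ≤ r}

/-- The in-ball of radius `r` based at `x`. -/
def inBall (G : Digraph V) (r : NNReal) (x : V) : Set V :=
  {y | ((dist G y x : ℕ∞) : ENNReal) ≤ r}

/-- A path is a geodesic if its length is the distance from its start to its end. -/
def IsGeodesic {G : Digraph V} (p : DiPath G) : Prop :=
  (p.length : ℕ∞) = dist G p.head p.last

/-- `(p, q, r)` is a geodesic triangle: three geodesics such that `p` and `q` are composable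
and the composite of `p` and `q` is parallel to `r`. -/
structure IsGeodesicTriangle {G : Digraph V} (p q r : DiPath G) : Prop where
  geodesic_left : IsGeodesic p
  geodesic_right : IsGeodesic q
  geodesic_hyp : IsGeodesic r
  composable : p.last = q.head
  head_eq : p.head = r.head
  last_eq : q.last = r.last

/-- Every vertex of the side `x` lies in the out-ball of radius `δ` around some vertex of the side
`y`, or in the in-ball of radius `δ` around some vertex of the side `z`. -/
def SideThin {G : Digraph V} (δ : NNReal) (x y z : DiPath G) : Prop :=
  ∀ v ∈ x, (∃ a ∈ y, v ∈ outBall G δ a) ∨ (∃ b ∈ z, v ∈ inBall G δ b)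

/-- The directed triangle `(p, q, r)` is `δ`-thin: each side is covered by the out-balls around the
side meeting its start and the in-balls around the side meeting its end. -/
def IsThin {G : Digraph V} (δ : NNReal) (p q r : DiPath G) : Prop :=
  SideThin δ r p q ∧ SideThin δ p r q ∧ SideThin δ q p r

/-- All geodesic triangles of `G` are `δ`-thin. -/
def StronglyDeltaHyperbolic (G : Digraph V) (δ : NNReal) : Prop :=
  ∀ p q r : DiPath G, IsGeodesicTriangle p q r → IsThin δ p q r

end Graph

section Monoid

variable (M : Type*) [Monoid M]

/-- The finite set `S` generates the monoid `M`. -/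
def Generates {M : Type*} [Monoid M] (S : Finset M) : Prop :=
  Submonoid.closure (S : Set M) = ⊤

/-- The right Cayley graph of `M` with respect to `S`: an edge from `m` to `m * s` for `s ∈ S`. -/
def rightCayley {M : Type*} [Monoid M] (S : Finset M) : Digraph M where
  Adj m n := ∃ s ∈ S, m * s = n

/-- The right Cayley graph with respect to some finite generating set is strongly
`δ`-hyperbolic for some `δ ≥ 0`. -/
def StronglyHyperbolic : Prop :=
  ∃ S : Finset M, Generates S ∧ ∃ δ : NNReal, StronglyDeltaHyperbolic (rightCayley S) δ

/-- With respect to some finite generating set, the right indegree is bounded by some natural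
number `α`: no generator `a` admits `α + 1` distinct elements `x₀, …, x_α` with
`x₀ a = ⋯ = x_α a`. -/
def BoundedIndegree : Prop :=
  ∃ S : Finset M, Generates S ∧ ∃ α : ℕ, ∀ a ∈ S,
    ¬ ∃ x : Fin (α + 1) → M, Function.Injective x ∧ ∀ i j, x i * a = x j * a

/-- The `R`-order: `a M ⊆ b M`. -/
def ROrder {M : Type*} [Monoid M] (a b : M) : Prop :=
  Set.range (fun m : M => a * m) ⊆ Set.range (fun m : M => b * m)

/-- The `L`-order: `M a ⊆ M b`. -/
def LOrder {M : Type*} [Monoid M] (a b : M) : Prop :=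
  Set.range (fun m : M => m * a) ⊆ Set.range (fun m : M => m * b)

end Monoid

section Machines

/-- A nondeterministic Turing machine with input alphabet `A` and `tapes + 1` two-way infinite
tapes. Tape symbols are the input letters, finitely many work symbols, and the blank `none`. In
one step the machine reads the scanned symbols, and chooses an element of `trans`: a new state and,
for each tape, a symbol to be written followed by a move of the head (`none`: no move). -/
structure NTM (A : Type*) where
  tapes : ℕ
  Work : Type
  finiteWork : Finite Work
  State : Type
  finiteState : Finite State
  start : State
  accept : State
  trans : State → (Fin (tapes + 1) → Option (A ⊕ Work)) →
    Set (State × (Fin (tapes + 1) → Option (A ⊕ Work) × Option Turing.Dir))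

namespace NTM

variable {A : Type*}

/-- Configurations: a state, and for each tape its contents together with the head position. -/
structure Cfg (N : NTM A) where
  state : N.State
  tape : Fin (N.tapes + 1) → Turing.Tape (Option (A ⊕ N.Work))

/-- The initial configuration: the input is on tape `0`, its first letter being scanned, and all
the other tapes are blank. -/
def init (N : NTM A) (x : List A) : N.Cfg where
  state := N.start
  tape := fun i => if i = 0 then Turing.Tape.mk₁ (x.map fun a => some (Sum.inl a))
    else Turing.Tape.mk₁ []

/-- Write a symbol, then move the head. -/
def act {Γ : Type*} [Inhabited Γ] (s : Γ × Option Turing.Dir) (T : Turing.Tape Γ) :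
    Turing.Tape Γ :=
  match s.2 with
  | none => T.write s.1
  | some d => (T.write s.1).move d

/-- `c'` is a possible successor of the configuration `c`. -/
def Step (N : NTM A) (c c' : N.Cfg) : Prop :=
  ∃ t ∈ N.trans c.state (fun i => (c.tape i).head),
    c'.state = t.1 ∧ c'.tape = fun i => act (t.2 i) (c.tape i)

/-- There is a computation of exactly `n` steps from the first to the second configuration. -/
inductive Reaches (N : NTM A) : ℕ → N.Cfg → N.Cfg → Prop
  | refl (c : N.Cfg) : Reaches N 0 c c
  | step {n : ℕ} {c d e : N.Cfg} : N.Step c d → Reaches N n d e → Reaches N (n + 1) c e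

/-- Some computation on input `x` is in the accepting state after `n` steps. -/
def AcceptsIn (N : NTM A) (x : List A) (n : ℕ) : Prop :=
  ∃ c : N.Cfg, N.Reaches n (N.init x) c ∧ c.state = N.accept

end NTM

/-- The class NP of languages over the finite alphabet `A`: some nondeterministic Turing
machine accepts exactly the words of `L`, and each word of `L` has an accepting computation whose
number of steps is bounded by a polynomial in the length of the word. -/
def InNP {A : Type*} [Finite A] (L : Language A) : Prop :=
  ∃ (N : NTM A) (p : Polynomial ℕ),
    (∀ x n, N.AcceptsIn x n → x ∈ L) ∧
    (∀ x ∈ L, ∃ n ≤ p.eval x.length, N.AcceptsIn x n)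

end Machines

/-- The decision problem for a relation `rel` on `M`, where elements of `M` are given by words over
an alphabet `A` whose letters represent elements of `M` via `f`: the language of all `u # v`, with
`u` and `v` words over `A` whose values in `M` are related. The separator `#` is `none`. -/
def relLanguage {A M : Type*} [Monoid M] (f : A → M) (rel : M → M → Prop) : Language (Option A) :=
  {x | ∃ u v : List A, x = u.map some ++ none :: v.map some ∧
    rel (u.map f).prod (v.map f).prod}

end HypMonoid

/-!
By left cancellation, a geodesic from `1` to `p`, a geodesic word for `q` read from `p`, and a
geodesic from `1` to `p * q` form a geodesic triangle. It is thin, and balls of a fixed radius have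
bounded size in both directions, since the indegree is bounded. Hence each side is at most linearly
longer than the other two, so that solutions `y` of `a = y * b` and `z` of `a = b * z` have words of
linear length.

Equality of the products is certified by local rewriting over a finite alphabet. Along a thin
triangle with sides `p`, `q`, `r` and `q` short, every vertex of `r` is reached from a vertex of `p`
by a short element. Sliding a letter for this element along turns `p * q` into `r` in linearly many
steps. A word is thus brought letter by letter to geodesic form in quadratically many steps, each of
them reversible. A nondeterministic machine that keeps a word with a cursor on two stacks rewrites
`u` in this way, and finally checks that the result consists of `v` and the guessed letters.
-/

namespace HypMonoid

section Words

variable {M : Type*} [Monoid M] {S : Finset M}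

/-- The ball of radius `n` around `1` in the right Cayley graph: the elements represented by words
of length at most `n` over `S`. -/
def wordBall (S : Finset M) (n : ℕ) : Set M :=
  {m | ∃ w : List M, (∀ s ∈ w, s ∈ S) ∧ w.length ≤ n ∧ w.prod = m}

/-- A word over `S` of minimal length among the words representing the same element. -/
def IsGeodesicWord (S : Finset M) (w : List M) : Prop :=
  (∀ s ∈ w, s ∈ S) ∧ ∀ w' : List M, (∀ s ∈ w', s ∈ S) → w'.prod = w.prod → w.length ≤ w'.length

theorem wordBall_mono {m n : ℕ} (h : m ≤ n) : wordBall S m ⊆ wordBall S n := by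
  rintro _ ⟨w, hw, hl, rfl⟩
  exact ⟨w, hw, hl.trans h, rfl⟩

theorem prod_mem_wordBall {w : List M} (hw : ∀ s ∈ w, s ∈ S) {n : ℕ} (hn : w.length ≤ n) :
    w.prod ∈ wordBall S n :=
  ⟨w, hw, hn, rfl⟩

theorem one_mem_wordBall (n : ℕ) : (1 : M) ∈ wordBall S n :=
  ⟨[], by simp, by simp, by simp⟩

theorem mem_wordBall_one {s : M} (hs : s ∈ S) : s ∈ wordBall S 1 :=
  ⟨[s], by simpa using hs, by simp, by simp⟩

theorem mul_mem_wordBall {a b : M} {m n : ℕ} (ha : a ∈ wordBall S m) (hb : b ∈ wordBall S n) :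
    a * b ∈ wordBall S (m + n) := by
  obtain ⟨u, hu, hul, rfl⟩ := ha
  obtain ⟨v, hv, hvl, rfl⟩ := hb
  exact ⟨u ++ v, List.forall_mem_append.2 ⟨hu, hv⟩, by simp; omega, by simp⟩

theorem prod_mem_wordBall_mul {k : ℕ} {w : List M} (hw : ∀ m ∈ w, m ∈ wordBall S k) :
    w.prod ∈ wordBall S (k * w.length) := by
  induction w with
  | nil => exact one_mem_wordBall _
  | cons m w ih =>
    obtain ⟨hm, hw⟩ := List.forall_mem_cons.1 hw
    rw [List.prod_cons, List.length_cons, Nat.mul_succ, add_comm]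
    exact mul_mem_wordBall hm (ih hw)

theorem finite_wordBall (S : Finset M) (n : ℕ) : (wordBall S n).Finite := by
  refine ((List.finite_length_le S n).image fun w => (w.map Subtype.val).prod).subset ?_
  rintro _ ⟨w, hw, hl, rfl⟩
  lift w to List S using hw
  exact ⟨w, by simpa using hl, rfl⟩

theorem exists_word (hS : Generates S) (m : M) : ∃ w : List M, (∀ s ∈ w, s ∈ S) ∧ w.prod = m :=
  Submonoid.exists_list_of_mem_closure (hS ▸ Submonoid.mem_top m)

theorem exists_geodesicWord (hS : Generates S) (m : M) :
    ∃ w : List M, IsGeodesicWord S w ∧ w.prod = m := by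
  let W : Set (List M) := {w | (∀ s ∈ w, s ∈ S) ∧ w.prod = m}
  have hW : W.Nonempty := exists_word hS m
  obtain ⟨hw, hm⟩ := Function.argminOn_mem List.length W hW
  exact ⟨_, ⟨hw, fun w' hw' h => Function.argminOn_le List.length W ⟨hw', h.trans hm⟩⟩, hm⟩

theorem exists_subset_wordBall (hS : Generates S) {X : Set M} (hX : X.Finite) :
    ∃ n, X ⊆ wordBall S n := by
  choose w hw hprod using exists_word hS
  obtain ⟨n, hn⟩ := (hX.image fun m => (w m).length).bddAbove
  exact ⟨n, fun m hm => ⟨w m, hw m, hn (Set.mem_image_of_mem _ hm), hprod m⟩⟩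

namespace IsGeodesicWord

variable {u v w : List M}

theorem length_le (hw : IsGeodesicWord S w) {n : ℕ} (h : w.prod ∈ wordBall S n) :
    w.length ≤ n := by
  obtain ⟨w', hw', hl, h'⟩ := h
  exact (hw.2 w' hw' h').trans hl

theorem of_infix (hw : IsGeodesicWord S w) (h : u <:+: w) : IsGeodesicWord S u := by
  obtain ⟨a, b, rfl⟩ := h
  refine ⟨fun s hs => hw.1 s (by simp [hs]), fun u' hu' hprod => ?_⟩
  have hle := hw.2 (a ++ u' ++ b) (by grind [hw.1]) (by simp [hprod])
  simpa using hle

theorem eq_of_prefix (hw : IsGeodesicWord S w) (hu : u <+: w) (hv : v <+: w)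
    (h : u.prod = v.prod) : u = v := by
  have hu' := hw.of_infix hu.isInfix
  have hv' := hw.of_infix hv.isInfix
  have hl : u.length = v.length := (hu'.2 v hv'.1 h.symm).antisymm (hv'.2 u hu'.1 h)
  exact (List.prefix_of_prefix_length_le hu hv hl.le).eq_of_length hl

end IsGeodesicWord

end Words

section Paths

theorem nodup_inits {α : Type*} (l : List α) : l.inits.Nodup := by
  induction l with
  | nil => simp
  | cons a l ih => simpa using ih.map (List.cons_injective)

variable {M : Type*} [Monoid M] {S : Finset M} {x y z : M} {u v w : List M}

/-- The vertices, in order, of the path in the right Cayley graph that starts at `x` and is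
labelled by the word `w`. -/
def vertices (x : M) (w : List M) : List M :=
  w.inits.map fun p => x * p.prod

theorem mem_vertices : y ∈ vertices x w ↔ ∃ p, p <+: w ∧ x * p.prod = y := by
  simp [vertices]

theorem length_vertices : (vertices x w).length = w.length + 1 := by
  simp [vertices]

theorem IsGeodesicWord.nodup_vertices [IsLeftCancelMul M] (hw : IsGeodesicWord S w) (x : M) :
    (vertices x w).Nodup := by
  refine List.Nodup.map_on (fun u hu v hv h => ?_) (nodup_inits w)
  exact hw.eq_of_prefix ((List.mem_inits _ _).1 hu) ((List.mem_inits _ _).1 hv)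
    (mul_left_cancel h)

/-- The path in the right Cayley graph that starts at `x` and is labelled by the word `w`. -/
def wordPath (x : M) (w : List M) (hw : ∀ s ∈ w, s ∈ S) : DiPath (rightCayley S) where
  length := w.length
  toFun i := x * (w.take i).prod
  step i := ⟨w[i.1], hw _ (List.getElem_mem _), by
    change x * (w.take i.1).prod * w[i.1] = x * (w.take (i.1 + 1)).prod
    rw [mul_assoc, List.prod_take_succ]⟩

theorem wordPath_head (x : M) (w : List M) (hw : ∀ s ∈ w, s ∈ S) :
    (wordPath x w hw).head = x := by
  simp [RelSeries.head, wordPath]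

theorem wordPath_last (x : M) (w : List M) (hw : ∀ s ∈ w, s ∈ S) :
    (wordPath x w hw).last = x * w.prod := by
  simp [RelSeries.last, wordPath]

theorem mem_wordPath {hw : ∀ s ∈ w, s ∈ S} : y ∈ wordPath x w hw ↔ y ∈ vertices x w := by
  rw [mem_vertices]
  constructor
  · rintro ⟨i, rfl⟩
    exact ⟨w.take i, w.take_prefix i, rfl⟩
  · rintro ⟨p, hp, rfl⟩
    refine ⟨⟨p.length, Nat.lt_succ_of_le hp.length_le⟩, ?_⟩
    change x * (w.take p.length).prod = x * p.prod
    rw [← List.prefix_iff_eq_take.1 hp]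

theorem exists_word_of_path (p : DiPath (rightCayley S)) :
    ∃ w : List M, (∀ s ∈ w, s ∈ S) ∧ w.length = p.length ∧ p.head * w.prod = p.last := by
  have initial_segment : ∀ i : ℕ, ∀ hi : i < p.length + 1,
      ∃ w : List M, (∀ s ∈ w, s ∈ S) ∧ w.length = i ∧ p.head * w.prod = p ⟨i, hi⟩ := by
    intro i
    induction i with
    | zero => exact fun _ => ⟨[], by simp, rfl, by simp [RelSeries.head]⟩
    | succ i ih =>
      intro hi
      obtain ⟨w, hw, hl, hp⟩ := ih (by omega)
      obtain ⟨s, hs, h⟩ := p.step ⟨i, by omega⟩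
      refine ⟨w ++ [s], by grind, by simp [hl], ?_⟩
      rw [List.prod_append, ← mul_assoc, hp, List.prod_singleton]
      exact h
  exact initial_segment p.length (Nat.lt_succ_self _)

theorem isGeodesic_wordPath [IsLeftCancelMul M] (x : M) (hw : IsGeodesicWord S w) :
    IsGeodesic (wordPath x w hw.1) := by
  refine le_antisymm (le_iInf ?_) (iInf_le_of_le ⟨wordPath x w hw.1, rfl, rfl⟩ le_rfl)
  rintro ⟨p, hhead, hlast⟩
  obtain ⟨w', hw', hl, hp⟩ := exists_word_of_path p
  rw [hhead, hlast, wordPath_head, wordPath_last] at hp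
  have hle : w.length ≤ p.length := hl ▸ hw.2 w' hw' (mul_left_cancel hp)
  exact_mod_cast hle

/-- The directed distance from `x` to `y` in the right Cayley graph is at most `D`. -/
def Near (S : Finset M) (D : ℕ) (x y : M) : Prop :=
  ∃ m ∈ wordBall S D, x * m = y

theorem near_of_dist_le {δ : NNReal}
    (h : ((dist (rightCayley S) x y : ℕ∞) : ENNReal) ≤ δ) : Near S ⌊δ⌋₊ x y := by
  have hne : Nonempty {p : DiPath (rightCayley S) // p.head = x ∧ p.last = y} := by
    by_contra! hempty
    simp [dist] at h
  obtain ⟨⟨p, rfl, rfl⟩, hp⟩ := ENat.exists_eq_iInf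
    fun p : {p : DiPath (rightCayley S) // p.head = x ∧ p.last = y} => (p.1.length : ℕ∞)
  obtain ⟨w, hw, hl, hprod⟩ := exists_word_of_path p
  rw [dist, ← hp, ENat.toENNReal_coe] at h
  have hlength : p.length ≤ ⌊δ⌋₊ := Nat.le_floor (by exact_mod_cast h)
  exact ⟨w.prod, ⟨w, hw, hl.trans_le hlength, rfl⟩, hprod⟩

/-- `SideThin` for the paths labelled by the words `u`, `v`, `w` and starting at `x`, `y`, `z`. -/
def WordSideThin (S : Finset M) (D : ℕ) (x : M) (u : List M) (y : M) (v : List M)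
    (z : M) (w : List M) : Prop :=
  ∀ a ∈ vertices x u, (∃ b ∈ vertices y v, Near S D b a) ∨ ∃ c ∈ vertices z w, Near S D a c

/-- The geodesic triangles starting at `1` are `D`-thin, in terms of the words labelling their
sides. By left cancellation all geodesic triangles are translates of these. -/
def ThinWordTriangles (S : Finset M) (D : ℕ) : Prop :=
  ∀ p q r : List M, IsGeodesicWord S p → IsGeodesicWord S q → IsGeodesicWord S r →
    p.prod * q.prod = r.prod →
    WordSideThin S D 1 r 1 p p.prod q ∧ WordSideThin S D 1 p 1 r p.prod q ∧
      WordSideThin S D p.prod q 1 p 1 r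

theorem wordSideThin_of_sideThin {δ : NNReal} {hu : ∀ s ∈ u, s ∈ S} {hv : ∀ s ∈ v, s ∈ S}
    {hw : ∀ s ∈ w, s ∈ S} (h : SideThin δ (wordPath x u hu) (wordPath y v hv) (wordPath z w hw)) :
    WordSideThin S ⌊δ⌋₊ x u y v z w := fun a ha =>
  (h a (mem_wordPath.2 ha)).imp
    (fun ⟨b, hb, hd⟩ => ⟨b, mem_wordPath.1 hb, near_of_dist_le hd⟩)
    (fun ⟨c, hc, hd⟩ => ⟨c, mem_wordPath.1 hc, near_of_dist_le hd⟩)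

theorem StronglyDeltaHyperbolic.thinWordTriangles [IsLeftCancelMul M] {δ : NNReal}
    (h : StronglyDeltaHyperbolic (rightCayley S) δ) : ThinWordTriangles S ⌊δ⌋₊ := by
  intro p q r hp hq hr hprod
  obtain ⟨hr', hp', hq'⟩ := h (wordPath 1 p hp.1) (wordPath p.prod q hq.1) (wordPath 1 r hr.1)
    ⟨isGeodesic_wordPath _ hp, isGeodesic_wordPath _ hq, isGeodesic_wordPath _ hr,
      by simp only [wordPath_head, wordPath_last, one_mul], by simp only [wordPath_head],
      by simp only [wordPath_last, one_mul, hprod]⟩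
  exact ⟨wordSideThin_of_sideThin hr', wordSideThin_of_sideThin hp', wordSideThin_of_sideThin hq'⟩

end Paths

section Division

theorem encard_biUnion_le_mul {ι α : Type*} {s : Set ι} {t : ι → Set α} {m n : ℕ}
    (hs : s.encard ≤ m) (ht : ∀ i ∈ s, (t i).encard ≤ n) : (⋃ i ∈ s, t i).encard ≤ m * n := by
  have hfin : s.Finite := Set.finite_of_encard_le_coe hs
  lift s to Finset ι using hfin
  calc (⋃ i ∈ s, t i).encard ≤ ∑ i ∈ s, (t i).encard := s.set_encard_biUnion_le t
    _ ≤ s.card • (n : ℕ∞) := s.sum_le_card_nsmul _ _ ht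
    _ ≤ m * n := by
      rw [nsmul_eq_mul]
      gcongr
      simpa using hs

variable {M : Type*} [Monoid M] {S : Finset M}

theorem BoundedIndegree.exists_encard_fibre_le (hdeg : BoundedIndegree M) (m : M) :
    ∃ N : ℕ, ∀ y : M, {x | x * m = y}.encard ≤ N := by
  obtain ⟨T, hT, α, hα⟩ := hdeg
  have hm : m ∈ Submonoid.closure (T : Set M) := hT ▸ Submonoid.mem_top m
  induction hm using Submonoid.closure_induction with
  | mem a ha =>
    refine ⟨α, fun y => ?_⟩
    by_contra! hlt
    obtain ⟨F, hF, hcard⟩ := Set.exists_subset_encard_eq (ENat.add_one_le_iff (by simp) |>.2 hlt)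
    have hfin : F.Finite := Set.finite_of_encard_eq_coe (k := α + 1) (by simpa using hcard)
    lift F to Finset M using hfin
    have hcard' : F.card = α + 1 := by
      rw [Set.encard_coe_eq_coe_finsetCard] at hcard
      exact_mod_cast hcard
    refine hα a ha ⟨fun i => (F.equivFinOfCardEq hcard').symm i,
      Subtype.val_injective.comp (Equiv.injective _), fun i j => ?_⟩
    exact (hF (Subtype.prop _)).trans (hF (Subtype.prop _)).symm
  | one => exact ⟨1, fun y => by simp⟩
  | mul a b _ _ iha ihb =>
    obtain ⟨Na, hNa⟩ := iha
    obtain ⟨Nb, hNb⟩ := ihb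
    refine ⟨Nb * Na, fun y => ?_⟩
    have hcover : {x | x * (a * b) = y} = ⋃ z ∈ {z | z * b = y}, {x | x * a = z} := by
      ext x
      simp [mul_assoc]
    rw [hcover]
    exact_mod_cast encard_biUnion_le_mul (hNb y) fun z _ => hNa z

theorem BoundedIndegree.exists_encard_near_le (hdeg : BoundedIndegree M) (S : Finset M) (D : ℕ) :
    ∃ N : ℕ, ∀ y : M, {x | Near S D x y}.encard ≤ N := by
  choose N hN using hdeg.exists_encard_fibre_le
  obtain ⟨K, hK⟩ := ((finite_wordBall S D).image N).bddAbove
  refine ⟨(wordBall S D).ncard * K, fun y => ?_⟩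
  have hcover : {x | Near S D x y} = ⋃ m ∈ wordBall S D, {x | x * m = y} := by
    ext x
    simp [Near]
  rw [hcover]
  exact_mod_cast encard_biUnion_le_mul (finite_wordBall S D).cast_ncard_eq.ge fun m hm =>
    (hN m y).trans (by exact_mod_cast hK (Set.mem_image_of_mem N hm))

theorem encard_setOf_near_le (S : Finset M) (D : ℕ) (x : M) :
    {y | Near S D x y}.encard ≤ (wordBall S D).ncard := by
  rw [(finite_wordBall S D).cast_ncard_eq]
  exact Set.encard_image_le (x * ·) (wordBall S D)

theorem encard_setOf_mem_vertices_le (x : M) (w : List M) :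
    {a | a ∈ vertices x w}.encard ≤ (w.length + 1 : ℕ) := by
  classical
  rw [← List.coe_toFinset, Set.encard_coe_eq_coe_finsetCard, Nat.cast_le,
    ← length_vertices (x := x)]
  exact List.toFinset_card_le _

theorem IsGeodesicWord.encard_setOf_mem_vertices [IsLeftCancelMul M] {w : List M}
    (hw : IsGeodesicWord S w) (x : M) : {a | a ∈ vertices x w}.encard = (w.length + 1 : ℕ) := by
  classical
  rw [← List.coe_toFinset, Set.encard_coe_eq_coe_finsetCard,
    List.toFinset_card_of_nodup (hw.nodup_vertices x), length_vertices]

theorem WordSideThin.length_le [IsLeftCancelMul M] {D N : ℕ} {x y z : M} {u v w : List M}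
    (h : WordSideThin S D x u y v z w) (hu : IsGeodesicWord S u)
    (hout : ∀ x, {y | Near S D x y}.encard ≤ N) (hin : ∀ y, {x | Near S D x y}.encard ≤ N) :
    u.length ≤ N * (v.length + w.length + 2) := by
  have hcover : {a | a ∈ vertices x u} ⊆ (⋃ b ∈ {b | b ∈ vertices y v}, {a | Near S D b a}) ∪
      ⋃ c ∈ {c | c ∈ vertices z w}, {a | Near S D a c} := fun a ha => by
    simpa using h a ha
  have hcard := (Set.encard_le_encard hcover).trans <| (Set.encard_union_le _ _).trans <| add_le_add
    (encard_biUnion_le_mul (encard_setOf_mem_vertices_le y v) fun b _ => hout b)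
    (encard_biUnion_le_mul (encard_setOf_mem_vertices_le z w) fun c _ => hin c)
  rw [hu.encard_setOf_mem_vertices] at hcard
  have hcard' : u.length + 1 ≤ (v.length + 1) * N + (w.length + 1) * N := by exact_mod_cast hcard
  linarith

/-- The length of each factor of `p * q` is at most linear in the lengths of `p * q` and of the
other factor. -/
def LinearDivision (S : Finset M) (C : ℕ) : Prop :=
  ∀ (p q : M) (m n : ℕ), p * q ∈ wordBall S n →
    (q ∈ wordBall S m → p ∈ wordBall S (C * (m + n + 2))) ∧
      (p ∈ wordBall S m → q ∈ wordBall S (C * (m + n + 2)))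

/-- Thinness covers each side of a geodesic triangle by boundedly large balls around the vertices
of the other two. -/
theorem ThinWordTriangles.exists_linearDivision [IsLeftCancelMul M] {D : ℕ}
    (hthin : ThinWordTriangles S D) (hS : Generates S) (hdeg : BoundedIndegree M) :
    ∃ C, LinearDivision S C := by
  obtain ⟨N, hN⟩ := hdeg.exists_encard_near_le S D
  let C := max N (wordBall S D).ncard
  have hout (x : M) : {y | Near S D x y}.encard ≤ C :=
    (encard_setOf_near_le S D x).trans (by exact_mod_cast le_max_right _ _)
  have hin (y : M) : {x | Near S D x y}.encard ≤ C :=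
    (hN y).trans (by exact_mod_cast le_max_left _ _)
  refine ⟨C, fun p q m n hpq => ?_⟩
  obtain ⟨u, hu, rfl⟩ := exists_geodesicWord hS p
  obtain ⟨v, hv, rfl⟩ := exists_geodesicWord hS q
  obtain ⟨w, hw, hprod⟩ := exists_geodesicWord hS (u.prod * v.prod)
  have hwn : w.length ≤ n := hw.length_le (hprod ▸ hpq)
  obtain ⟨-, hthin_u, hthin_v⟩ := hthin u v w hu hv hw hprod.symm
  refine ⟨fun hq => prod_mem_wordBall hu.1 ?_, fun hp => prod_mem_wordBall hv.1 ?_⟩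
  · have hvm := hv.length_le hq
    exact (hthin_u.length_le hu hout hin).trans (Nat.mul_le_mul_left C (by omega))
  · have hum := hu.length_le hp
    exact (hthin_v.length_le hv hout hin).trans (Nat.mul_le_mul_left C (by omega))

end Division

section ReachesWithin

variable {α β : Type*} {r : α → α → Prop} {m n : ℕ} {a b c : α}

/-- Some chain of at most `n` steps of the relation `r` leads from the first to the second
argument. -/
inductive ReachesWithin (r : α → α → Prop) : ℕ → α → α → Prop
  | refl (n : ℕ) (a : α) : ReachesWithin r n a a
  | head {n : ℕ} {a b c : α} : r a b → ReachesWithin r n b c → ReachesWithin r (n + 1) a c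

namespace ReachesWithin

theorem single (h : r a b) : ReachesWithin r 1 a b :=
  .head h (.refl 0 b)

theorem mono (h : ReachesWithin r m a b) (hmn : m ≤ n) : ReachesWithin r n a b := by
  induction h generalizing n with
  | refl => exact .refl _ _
  | head hab _ ih =>
    obtain ⟨n, rfl⟩ := Nat.exists_eq_add_of_le' (Nat.one_le_of_lt hmn)
    exact .head hab (ih (Nat.le_of_succ_le_succ hmn))

theorem trans (hab : ReachesWithin r m a b) (hbc : ReachesWithin r n b c) :
    ReachesWithin r (m + n) a c := by
  induction hab with
  | refl => exact hbc.mono (Nat.le_add_left _ _)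
  | head h _ ih =>
    rw [Nat.add_right_comm]
    exact .head h (ih hbc)

theorem symm (hr : ∀ a b, r a b → r b a) (h : ReachesWithin r n a b) : ReachesWithin r n b a := by
  induction h with
  | refl => exact .refl _ _
  | head hab _ ih => exact ih.trans (single (hr _ _ hab))

theorem lift {s : β → β → Prop} {f : α → β} {k : ℕ}
    (hf : ∀ a b, r a b → ReachesWithin s k (f a) (f b)) (h : ReachesWithin r n a b) :
    ReachesWithin s (k * n) (f a) (f b) := by
  induction h with
  | refl => exact .refl _ _
  | head hab _ ih =>
    rw [Nat.mul_succ, add_comm]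
    exact (hf _ _ hab).trans ih

end ReachesWithin

end ReachesWithin

section CursorWords

variable {M : Type*} [Monoid M]

/-- A word with a cursor in it: `(L, R)` stands for the word `L.reverse ++ R`, so that both lists
start at the cursor and can serve as stacks. -/
abbrev CursorWord (M : Type*) := List M × List M

/-- A local change of a cursor word over `B` that keeps its product in the monoid. -/
inductive BasicMove (B : Set M) : CursorWord M → CursorWord M → Prop
  | shift {x : M} (L R : List M) (hx : x ∈ B) : BasicMove B (x :: L, R) (L, x :: R)
  | merge {x y : M} (L R : List M) (hx : x ∈ B) (hy : y ∈ B) (hxy : x * y ∈ B) :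
      BasicMove B (x :: L, y :: R) (L, x * y :: R)
  | erase (L R : List M) (h : (1 : M) ∈ B) : BasicMove B (L, 1 :: R) (L, R)

/-- A `BasicMove` or the inverse of one. -/
abbrev Move (B : Set M) : CursorWord M → CursorWord M → Prop :=
  Relation.SymmGen (BasicMove B)

/-- Every finite set of letters lies in a finite set `B` such that any two words over the given
letters with the same product, and with cursors anywhere, are connected by a number of moves over
`B` that is quadratic in their lengths. -/
def QuadraticIsoperimetry (M : Type*) [Monoid M] : Prop :=
  ∀ X : Set M, X.Finite → ∃ B : Set M, B.Finite ∧ X ⊆ B ∧ ∃ c : ℕ, ∀ u₁ u₂ v₁ v₂ : List M,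
    (∀ s ∈ u₁ ++ u₂, s ∈ X) → (∀ s ∈ v₁ ++ v₂, s ∈ X) → (u₁ ++ u₂).prod = (v₁ ++ v₂).prod →
    ReachesWithin (Move B) (c * ((u₁ ++ u₂).length + (v₁ ++ v₂).length + 1) ^ 2)
      (u₁.reverse, u₂) (v₁.reverse, v₂)

variable {B : Set M}

theorem ReachesWithin.symm_move {n : ℕ} {c d : CursorWord M} (h : ReachesWithin (Move B) n c d) :
    ReachesWithin (Move B) n d c :=
  h.symm fun _ _ => Or.symm

theorem reachesWithin_shift {w : List M} (hw : ∀ s ∈ w, s ∈ B) (L R : List M) :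
    ReachesWithin (Move B) w.length (L, w ++ R) (w.reverse ++ L, R) := by
  induction w generalizing L with
  | nil => exact .refl _ _
  | cons s w ih =>
    obtain ⟨hs, hw⟩ := List.forall_mem_cons.1 hw
    rw [List.reverse_cons, List.append_assoc]
    exact .head (.inr (.shift L (w ++ R) hs)) (ih hw (s :: L))

theorem reachesWithin_absorb {t : List M} {b : M} (ht : ∀ s ∈ t, s ∈ B)
    (hb : ∀ t', t' <:+ t → t'.prod * b ∈ B) (L R : List M) :
    ReachesWithin (Move B) t.length (t.reverse ++ L, b :: R) (L, t.prod * b :: R) := by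
  induction t generalizing L with
  | nil => simpa using ReachesWithin.refl _ _
  | cons s t ih =>
    obtain ⟨hs, ht⟩ := List.forall_mem_cons.1 ht
    have hmerge : Move B (s :: L, t.prod * b :: R) (L, s * (t.prod * b) :: R) :=
      .inl (.merge L R hs (hb t (List.suffix_cons s t))
        (by simpa [mul_assoc] using hb (s :: t) List.suffix_rfl))
    have habsorb := ih ht (fun t' h => hb t' (h.trans (List.suffix_cons s t))) (s :: L)
    rw [List.reverse_cons, List.append_assoc, List.prod_cons, mul_assoc]
    exact habsorb.trans (.single hmerge)

theorem reachesWithin_split {x y : M} (hx : x ∈ B) (hy : y ∈ B) (hxy : x * y ∈ B) (L R : List M) :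
    ReachesWithin (Move B) 2 (L, x * y :: R) (L, x :: y :: R) :=
  .head (.inr (.merge L R hx hy hxy)) (.single (.inl (.shift L (y :: R) hx)))

end CursorWords

section Filling

variable {M : Type*} [Monoid M] {S : Finset M} {D C F k : ℕ}

theorem Near.mono {m n : ℕ} {x y : M} (h : Near S m x y) (hmn : m ≤ n) : Near S n x y := by
  obtain ⟨a, ha, h⟩ := h
  exact ⟨a, wordBall_mono hmn ha, h⟩

theorem Near.mul_right {n : ℕ} {x y s : M} (h : Near S n x y) (hs : s ∈ S) :
    Near S (n + 1) x (y * s) := by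
  obtain ⟨a, ha, rfl⟩ := h
  exact ⟨a * s, mul_mem_wordBall ha (mem_wordBall_one hs), (mul_assoc x a s).symm⟩

theorem LinearDivision.reachesWithin_absorb_geodesic (hC : LinearDivision S C) {t : List M}
    (ht : IsGeodesicWord S t) {a : M} (ha : a ∈ wordBall S F) (hta : t.prod * a ∈ wordBall S F)
    (L R : List M) :
    ReachesWithin (Move (wordBall S (C * (2 * F + 2) + F))) (C * (2 * F + 2))
      (t.reverse ++ L, a :: R) (L, t.prod * a :: R) := by
  have hlen : t.length ≤ C * (2 * F + 2) := by
    rw [two_mul]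
    exact ht.length_le ((hC _ _ _ _ hta).1 ha)
  rcases Nat.eq_zero_or_pos t.length with hnil | hpos
  · obtain rfl := List.length_eq_zero_iff.1 hnil
    simpa using ReachesWithin.refl _ _
  refine (reachesWithin_absorb (fun s hs => ?_) (fun t' ht' => ?_) L R).mono hlen
  · exact wordBall_mono (by omega) (mem_wordBall_one (ht.1 s hs))
  · exact mul_mem_wordBall (prod_mem_wordBall (fun s hs => ht.1 s (ht'.subset hs))
      (ht'.length_le.trans hlen)) ha

/-- A geodesic word followed by an element of `wordBall S k` can be rewritten to any geodesic word
with the same product, in a number of moves linear in the length of the latter. -/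
def TriangleFilling (S : Finset M) (k : ℕ) (B : Set M) (K : ℕ) : Prop :=
  ∀ p r : List M, IsGeodesicWord S p → IsGeodesicWord S r → ∀ a ∈ wordBall S k,
    p.prod * a = r.prod → ∀ R : List M,
    ReachesWithin (Move B) (K * (r.length + 1)) (p.reverse, a :: R) (r.reverse, R)

theorem TriangleFilling.reachesWithin_geodesic {B : Set M} {K : ℕ}
    (hfill : TriangleFilling S k B K) (hS : Generates S) {u w : List M}
    (hu : ∀ m ∈ u, m ∈ wordBall S k) (hw : IsGeodesicWord S w) (h : u.prod = w.prod)
    (R : List M) :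
    ReachesWithin (Move B) (u.length * (K * (k * u.length + 1))) ([], u ++ R) (w.reverse, R) := by
  induction u using List.reverseRecOn generalizing w R with
  | nil =>
    have hnil : w.length ≤ 0 := hw.length_le (h ▸ one_mem_wordBall 0)
    rw [List.length_eq_zero_iff.1 (Nat.le_zero.1 hnil)]
    exact .refl _ _
  | append_singleton u a ih =>
    have hlen : w.length ≤ k * (u ++ [a]).length := hw.length_le (h ▸ prod_mem_wordBall_mul hu)
    obtain ⟨hu, ha⟩ := List.forall_mem_append.1 hu
    obtain ⟨g, hg, hgu⟩ := exists_geodesicWord hS u.prod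
    have htriangle := hfill g w hg hw a (ha a (by simp)) (by rw [hgu, ← h]; simp) R
    rw [List.length_append, List.length_singleton] at hlen ⊢
    rw [List.append_assoc]
    refine ((ih hu hg hgu.symm (a :: R)).trans htriangle).mono ?_
    calc u.length * (K * (k * u.length + 1)) + K * (w.length + 1)
        ≤ u.length * (K * (k * (u.length + 1) + 1)) + K * (k * (u.length + 1) + 1) := by
          gcongr
          exact Nat.le_succ _
      _ = (u.length + 1) * (K * (k * (u.length + 1) + 1)) := by ring

variable [IsLeftCancelMul M]

/-- A vertex `r₁` of `r` that is not close to `p` is close to a vertex of the short side `q`, and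
hence to the end of the geodesic `r`. -/
theorem ThinWordTriangles.near_prefix_or_length_le (hthin : ThinWordTriangles S D)
    {p q r₁ r₂ : List M} (hp : IsGeodesicWord S p) (hq : IsGeodesicWord S q)
    (hr : IsGeodesicWord S (r₁ ++ r₂)) (hprod : p.prod * q.prod = (r₁ ++ r₂).prod)
    (hk : q.length ≤ k) :
    (∃ p₁, p₁ <+: p ∧ Near S D p₁.prod r₁.prod) ∨ r₂.length ≤ D + k := by
  have hvertex : r₁.prod ∈ vertices 1 (r₁ ++ r₂) :=
    mem_vertices.2 ⟨r₁, List.prefix_append r₁ r₂, one_mul _⟩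
  rcases (hthin p q (r₁ ++ r₂) hp hq hr hprod).1 _ hvertex with ⟨b, hb, hnear⟩ | ⟨c, hc, hnear⟩
  · obtain ⟨p₁, hp₁, rfl⟩ := mem_vertices.1 hb
    exact .inl ⟨p₁, hp₁, by simpa using hnear⟩
  · right
    obtain ⟨q₁, ⟨q₂, rfl⟩, rfl⟩ := mem_vertices.1 hc
    obtain ⟨m, hm, hm'⟩ := hnear
    have hr₂ : r₂.prod = m * q₂.prod := by
      apply mul_left_cancel (a := r₁.prod)
      rw [← List.prod_append, ← hprod, List.prod_append, ← mul_assoc, ← mul_assoc, hm']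
    refine (hr.of_infix (List.suffix_append r₁ r₂).isInfix).length_le ?_
    rw [hr₂]
    exact mul_mem_wordBall hm (prod_mem_wordBall (fun s hs => hq.1 s (by simp [hs]))
      (by rw [List.length_append] at hk; omega))

theorem ThinWordTriangles.exists_near_prefix (hthin : ThinWordTriangles S D)
    {p q r₁ r₂ : List M} (hp : IsGeodesicWord S p) (hq : IsGeodesicWord S q)
    (hr : IsGeodesicWord S (r₁ ++ r₂)) (hprod : p.prod * q.prod = (r₁ ++ r₂).prod)
    (hk : q.length ≤ k) : ∃ p₁, p₁ <+: p ∧ Near S (2 * D + k + 1) p₁.prod r₁.prod := by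
  suffices h : ∃ p₁, p₁ <+: p ∧ Near S (D + (D + k + 1 - r₂.length)) p₁.prod r₁.prod by
    obtain ⟨p₁, hp₁, hnear⟩ := h
    exact ⟨p₁, hp₁, hnear.mono (by omega)⟩
  induction r₁ using List.reverseRecOn generalizing r₂ with
  | nil => exact ⟨[], List.nil_prefix, 1, one_mem_wordBall _, mul_one _⟩
  | append_singleton r₁ s ih =>
    rcases hthin.near_prefix_or_length_le hp hq hr hprod hk with ⟨p₁, hp₁, hnear⟩ | hlast
    · exact ⟨p₁, hp₁, hnear.mono (by omega)⟩
    · rw [List.append_assoc] at hr hprod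
      obtain ⟨p₁, hp₁, hnear⟩ := ih hr hprod
      rw [List.prod_append, List.prod_singleton]
      refine ⟨p₁, hp₁, (hnear.mul_right (hr.1 s (by simp))).mono ?_⟩
      simp only [List.cons_append, List.nil_append, List.length_cons]
      omega

theorem LinearDivision.reachesWithin_transfer (hC : LinearDivision S C) {p p₁ p₂ : List M}
    (hp : IsGeodesicWord S p) (hp₁ : p₁ <+: p) (hp₂ : p₂ <+: p) {a b : M}
    (ha : a ∈ wordBall S F) (hb : b ∈ wordBall S F) (h : p₁.prod * a = p₂.prod * b) (R : List M) :
    ReachesWithin (Move (wordBall S (C * (2 * F + 2) + F))) (C * (2 * F + 2))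
      (p₁.reverse, a :: R) (p₂.reverse, b :: R) := by
  wlog hprefix : p₂ <+: p₁ generalizing p₁ p₂ a b
  · exact (this hp₂ hp₁ hb ha h.symm
      ((List.prefix_or_prefix_of_prefix hp₁ hp₂).resolve_right hprefix)).symm_move
  obtain ⟨t, rfl⟩ := hprefix
  have ht : IsGeodesicWord S t :=
    hp.of_infix ((List.suffix_append p₂ t).isInfix.trans hp₁.isInfix)
  obtain rfl : t.prod * a = b := by
    rw [List.prod_append, mul_assoc] at h
    exact mul_left_cancel h
  rw [List.reverse_append]
  exact hC.reachesWithin_absorb_geodesic ht ha hb _ _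

/-- The cursor retreats along `p`, leaving `r` on its right letter by letter: the letter at the
cursor leads from a vertex of `p` to the vertex of `r` reached so far. -/
theorem ThinWordTriangles.reachesWithin_unroll (hthin : ThinWordTriangles S D)
    (hC : LinearDivision S C) (hF : F = 2 * D + k + 2) {p q r₁ r₂ : List M}
    (hp : IsGeodesicWord S p) (hq : IsGeodesicWord S q) (hr : IsGeodesicWord S (r₁ ++ r₂))
    (hprod : p.prod * q.prod = (r₁ ++ r₂).prod) (hk : q.length ≤ k) {p₁ : List M}
    (hp₁ : p₁ <+: p) {a : M} (ha : a ∈ wordBall S F) (h : p₁.prod * a = r₁.prod) (R : List M) :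
    ReachesWithin (Move (wordBall S (C * (2 * F + 2) + F)))
      ((C * (2 * F + 2) + 2) * (r₁.length + 1)) (p₁.reverse, a :: R) ([], r₁ ++ R) := by
  induction r₁ using List.reverseRecOn generalizing p₁ a r₂ R with
  | nil =>
    have htransfer := hC.reachesWithin_transfer hp hp₁ List.nil_prefix ha
      (one_mem_wordBall F) (h.trans (mul_one _).symm) R
    exact (htransfer.trans (.single (.inl (.erase _ _ (one_mem_wordBall _))))).mono (by simp)
  | append_singleton r₁ s ih =>
    have hs : s ∈ S := hr.1 s (by simp)
    rw [List.append_assoc] at hr hprod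
    obtain ⟨p₂, hp₂, b, hb, hb'⟩ := hthin.exists_near_prefix hp hq hr hprod hk
    have hbs : b * s ∈ wordBall S F :=
      wordBall_mono (by omega) (mul_mem_wordBall hb (mem_wordBall_one hs))
    have htransfer := hC.reachesWithin_transfer hp hp₁ hp₂ ha hbs
      (by rw [h, List.prod_append, List.prod_singleton, ← hb', mul_assoc]) R
    have hsplit := reachesWithin_split (B := wordBall S (C * (2 * F + 2) + F))
      (wordBall_mono (by omega) hb) (wordBall_mono (by omega) (mem_wordBall_one hs))
      (wordBall_mono (by omega) hbs) p₂.reverse R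
    have hunroll := ih hr hprod hp₂ (wordBall_mono (by omega) hb) hb' (s :: R)
    rw [List.append_assoc, List.length_append, List.length_singleton]
    exact (htransfer.trans (hsplit.trans hunroll)).mono (by ring_nf; rfl)

theorem ThinWordTriangles.exists_triangleFilling (hthin : ThinWordTriangles S D)
    (hS : Generates S) (hC : LinearDivision S C) (k : ℕ) :
    ∃ n K, k ≤ n ∧ TriangleFilling S k (wordBall S n) K := by
  set F := 2 * D + k + 2 with hF
  refine ⟨C * (2 * F + 2) + F, C * (2 * F + 2) + 3, by omega, fun p r hp hr a ha h R => ?_⟩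
  obtain ⟨q, hq, rfl⟩ := exists_geodesicWord hS a
  have hunroll := hthin.reachesWithin_unroll (r₁ := r) (r₂ := []) hC hF hp hq
    (by simpa using hr) (by simpa using h) (hq.length_le ha) List.prefix_rfl
    (wordBall_mono (by omega) ha) h R
  have hshift := reachesWithin_shift (B := wordBall S (C * (2 * F + 2) + F))
    (fun s hs => wordBall_mono (by omega) (mem_wordBall_one (hr.1 s hs))) [] R
  rw [List.append_nil] at hshift
  exact (hunroll.trans hshift).mono (by linarith)

theorem quadraticIsoperimetry (hS : Generates S) (hthin : ThinWordTriangles S D)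
    (hC : LinearDivision S C) : QuadraticIsoperimetry M := by
  intro X hX
  obtain ⟨k, hk⟩ := exists_subset_wordBall hS hX
  obtain ⟨n, K, hkn, hfill⟩ := hthin.exists_triangleFilling hS hC k
  have hXB : X ⊆ wordBall S n := hk.trans (wordBall_mono hkn)
  have reaches_normal_form (u₁ u₂ w : List M) (hu : ∀ s ∈ u₁ ++ u₂, s ∈ X)
      (hw : IsGeodesicWord S w) (h : (u₁ ++ u₂).prod = w.prod) :
      ReachesWithin (Move (wordBall S n)) ((K * (k + 1) + 1) * ((u₁ ++ u₂).length *
        ((u₁ ++ u₂).length + 1))) (u₁.reverse, u₂) (w.reverse, []) := by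
    have hshift := (reachesWithin_shift (fun s hs => hXB (hu s (List.mem_append_left _ hs)))
      [] u₂).symm_move
    have hgeo := hfill.reachesWithin_geodesic hS (fun s hs => hk (hu s hs)) hw h []
    rw [List.append_nil] at hshift hgeo
    refine (hshift.trans hgeo).mono ?_
    rw [List.length_append]
    nlinarith [Nat.zero_le (K * k * u₁.length), Nat.zero_le (K * k * u₂.length),
      Nat.zero_le (K * (u₁.length + u₂.length) ^ 2)]
  refine ⟨wordBall S n, finite_wordBall S n, hXB, K * (k + 1) + 1, ?_⟩
  intro u₁ u₂ v₁ v₂ hu hv huv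
  obtain ⟨w, hw, hwu⟩ := exists_geodesicWord hS (u₁ ++ u₂).prod
  refine ((reaches_normal_form u₁ u₂ w hu hw hwu.symm).trans
    (reaches_normal_form v₁ v₂ w hv hw (huv ▸ hwu.symm)).symm_move).mono ?_
  rw [← mul_add]
  gcongr
  nlinarith

end Filling

section StackMachines

open Turing

variable {A : Type*}

theorem ReachesWithin.exists_reaches {N : NTM A} {n : ℕ} {c d : N.Cfg}
    (h : ReachesWithin N.Step n c d) : ∃ m ≤ n, N.Reaches m c d := by
  induction h with
  | refl n c => exact ⟨0, n.zero_le, .refl c⟩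
  | head hstep _ ih =>
    obtain ⟨m, hm, hreach⟩ := ih
    exact ⟨m + 1, Nat.succ_le_succ hm, .step hstep hreach⟩

/-- A nondeterministic machine whose memory consists of `extraStacks + 1` stacks, with the input on
stack `0`. The relation `rule q pop q' push` says that in state `q` the machine may enter state
`q'` while removing the symbol `pop i` from the top of stack `i` and then putting `push i` there
(`none`: no removal, nothing put there). It accepts in state `accept`, provided that the stacks
satisfying `emptied` are empty. Only work symbols are pushed, so that `push` lives in `Type`,
as the states of an `NTM` do. -/
structure StackMachine (A : Type*) where
  extraStacks : ℕ
  Work : Type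
  finiteWork : Finite Work
  State : Type
  finiteState : Finite State
  start : State
  accept : State
  emptied : Fin (extraStacks + 1) → Prop
  rule : State → (Fin (extraStacks + 1) → Option (A ⊕ Work)) →
    State → (Fin (extraStacks + 1) → Option Work) → Prop

namespace StackMachine

/-- Configurations: a state and the contents of the stacks, listed from the top. -/
structure Cfg (N : StackMachine A) where
  state : N.State
  stack : Fin (N.extraStacks + 1) → List (A ⊕ N.Work)

/-- The initial configuration: the input is on stack `0`, the other stacks are empty. -/
def init (N : StackMachine A) (x : List A) : N.Cfg where
  state := N.start
  stack := fun i => if i = 0 then x.map Sum.inl else []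

/-- A stack with contents `rest` after the work symbol `p`, if there is one, has been pushed. -/
def pushed {Λ : Type*} (p : Option Λ) (rest : List (A ⊕ Λ)) : List (A ⊕ Λ) :=
  (p.map Sum.inr).toList ++ rest

/-- The application of one rule. -/
inductive Step (N : StackMachine A) : N.Cfg → N.Cfg → Prop
  | intro {q q' : N.State} {pop : Fin (N.extraStacks + 1) → Option (A ⊕ N.Work)}
      {push : Fin (N.extraStacks + 1) → Option N.Work} (hrule : N.rule q pop q' push)
      (rest : Fin (N.extraStacks + 1) → List (A ⊕ N.Work)) :
      Step N ⟨q, fun i => (pop i).toList ++ rest i⟩ ⟨q', fun i => pushed (push i) (rest i)⟩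

/-- Some computation on input `x` accepts after at most `n` steps. -/
def AcceptsWithin (N : StackMachine A) (x : List A) (n : ℕ) : Prop :=
  ∃ c : N.Cfg, ReachesWithin N.Step n (N.init x) c ∧ c.state = N.accept ∧
    ∀ i, N.emptied i → c.stack i = []

theorem AcceptsWithin.mono {N : StackMachine A} {x : List A} {m n : ℕ} (h : N.AcceptsWithin x m)
    (hmn : m ≤ n) : N.AcceptsWithin x n :=
  let ⟨c, hreach, haccept⟩ := h
  ⟨c, hreach.mono hmn, haccept⟩

/-- The tape that holds a stack: the top is scanned, and everything to its left is blank. -/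
def stackTape {Λ : Type*} (l : List Λ) : Tape (Option Λ) :=
  Tape.mk₁ (l.map some)

/-- The tape that holds a stack while the blank cell to the left of its top is scanned. -/
def gapTape {Λ : Type*} (l : List Λ) : Tape (Option Λ) :=
  (stackTape l).move Dir.left

/-- The tape operation that removes the top `s` of a stack if `pop` demands it, and leads to the
`gapTape` of the remaining stack. -/
def popAct {Λ : Type*} (pop s : Option Λ) : Option Λ × Option Dir :=
  if pop.isSome then (none, none) else (s, some Dir.left)

/-- The tape operation that leads from a `gapTape` to the `stackTape` with `p` pushed. -/
def pushAct {Λ : Type*} : Option Λ → Option (A ⊕ Λ) × Option Dir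
  | none => (none, some Dir.right)
  | some g => (some (Sum.inr g), none)

theorem head_stackTape {Λ : Type*} (l : List Λ) : (stackTape l).head = l.head? := by
  cases l <;> rfl

theorem gapTape_eq_mk' {Λ : Type*} (l : List Λ) :
    gapTape l = Tape.mk' (ListBlank.mk []) (ListBlank.mk (none :: l.map some)) := by
  rw [gapTape, stackTape, Tape.mk₁, Tape.mk₂, Tape.move_left_mk', ListBlank.tail_mk,
    ListBlank.head_mk, ListBlank.cons_mk]
  rfl

theorem act_popAct {Λ : Type*} (pop : Option Λ) (rest : List Λ) :
    NTM.act (popAct pop (stackTape (pop.toList ++ rest)).head) (stackTape (pop.toList ++ rest)) =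
      gapTape rest := by
  cases pop with
  | none => exact congrArg (Tape.move Dir.left) (Tape.write_self (stackTape rest))
  | some s =>
    rw [gapTape_eq_mk', ← ListBlank.cons_mk]
    rfl

theorem act_pushAct {Λ : Type*} (p : Option Λ) (rest : List (A ⊕ Λ)) :
    NTM.act (pushAct p) (gapTape rest) = stackTape (pushed p rest) := by
  cases p with
  | none =>
    have hwrite : (gapTape rest).write none = gapTape rest := by
      rw [gapTape_eq_mk', ← ListBlank.cons_mk, Tape.write_mk', ListBlank.tail_cons]
    change ((gapTape rest).write none).move Dir.right = stackTape rest
    rw [hwrite, gapTape, Tape.move_left_right]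
  | some g =>
    change (gapTape rest).write (some (Sum.inr g)) = _
    rw [gapTape_eq_mk', ← ListBlank.cons_mk, Tape.write_mk', ListBlank.cons_mk]
    rfl

variable (N : StackMachine A)

/-- The states of the simulating Turing machine: `run q` before the application of a rule in state
`q`, `push q p` when the symbols `p` are still to be pushed, and the accepting state `done`. -/
inductive SimState : Type
  | run (q : N.State)
  | push (q : N.State) (p : Fin (N.extraStacks + 1) → Option N.Work)
  | done

theorem finite_simState : Finite N.SimState := by
  have := N.finiteWork
  have := N.finiteState
  let toSimState :
      Option (N.State ⊕ N.State × (Fin (N.extraStacks + 1) → Option N.Work)) → N.SimState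
    | none => .done
    | some (.inl q) => .run q
    | some (.inr (q, p)) => .push q p
  refine Finite.of_surjective toSimState ?_
  rintro (q | ⟨q, p⟩ | _)
  exacts [⟨some (.inl q), rfl⟩, ⟨some (.inr (q, p)), rfl⟩, ⟨none, rfl⟩]

/-- The transitions of the simulating Turing machine, which keeps each stack on a tape of its own
and takes two steps, one for popping and one for pushing, to apply a rule. -/
inductive SimTrans : N.SimState → (Fin (N.extraStacks + 1) → Option (A ⊕ N.Work)) →
    N.SimState × (Fin (N.extraStacks + 1) → Option (A ⊕ N.Work) × Option Dir) → Prop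
  | pop {q q' : N.State} {pop head : Fin (N.extraStacks + 1) → Option (A ⊕ N.Work)}
      {push : Fin (N.extraStacks + 1) → Option N.Work} (hrule : N.rule q pop q' push)
      (hpop : ∀ i, ∀ s ∈ pop i, head i = some s) :
      SimTrans (.run q) head (.push q' push, fun i => popAct (pop i) (head i))
  | push (q : N.State) (p : Fin (N.extraStacks + 1) → Option N.Work)
      (head : Fin (N.extraStacks + 1) → Option (A ⊕ N.Work)) :
      SimTrans (.push q p) head (.run q, fun i => pushAct (p i))
  | accept {head : Fin (N.extraStacks + 1) → Option (A ⊕ N.Work)}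
      (hhead : ∀ i, N.emptied i → head i = none) :
      SimTrans (.run N.accept) head (.done, fun i => (head i, none))

/-- The simulating Turing machine. -/
abbrev toNTM : NTM A where
  tapes := N.extraStacks
  Work := N.Work
  finiteWork := N.finiteWork
  State := N.SimState
  finiteState := N.finite_simState
  start := .run N.start
  accept := .done
  trans := fun q head => {t | N.SimTrans q head t}

/-- The configuration of the simulating Turing machine that represents `c`. -/
def simCfg (c : N.Cfg) : N.toNTM.Cfg where
  state := .run c.state
  tape := fun i => stackTape (c.stack i)

theorem toNTM_init (x : List A) : N.toNTM.init x = N.simCfg (N.init x) := by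
  refine congrArg (NTM.Cfg.mk _) (funext fun i => ?_)
  change (if i = 0 then _ else _) = stackTape (if i = 0 then _ else _)
  rw [apply_ite stackTape, stackTape, List.map_map]
  rfl

/-- The configuration of the simulating Turing machine in the middle of the application of a
rule. -/
def gapCfg (q : N.State) (p : Fin (N.extraStacks + 1) → Option N.Work)
    (rest : Fin (N.extraStacks + 1) → List (A ⊕ N.Work)) : N.toNTM.Cfg where
  state := .push q p
  tape := fun i => gapTape (rest i)

variable {N}

theorem step_simCfg_gapCfg {q q' : N.State} {pop : Fin (N.extraStacks + 1) → Option (A ⊕ N.Work)}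
    {push : Fin (N.extraStacks + 1) → Option N.Work} (hrule : N.rule q pop q' push)
    (rest : Fin (N.extraStacks + 1) → List (A ⊕ N.Work)) :
    N.toNTM.Step (N.simCfg ⟨q, fun i => (pop i).toList ++ rest i⟩) (N.gapCfg q' push rest) := by
  refine ⟨_, SimTrans.pop hrule fun i s hs => ?_, rfl, funext fun i => (act_popAct _ _).symm⟩
  rw [Option.mem_def] at hs
  simp only [simCfg, head_stackTape, hs, Option.toList_some, List.cons_append, List.head?_cons]

theorem step_gapCfg_simCfg (q : N.State) (p : Fin (N.extraStacks + 1) → Option N.Work)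
    (rest : Fin (N.extraStacks + 1) → List (A ⊕ N.Work)) :
    N.toNTM.Step (N.gapCfg q p rest) (N.simCfg ⟨q, fun i => pushed (p i) (rest i)⟩) :=
  ⟨_, SimTrans.push q p _, rfl, funext fun _ => (act_pushAct _ _).symm⟩

theorem Step.reachesWithin_simCfg {c d : N.Cfg} (h : N.Step c d) :
    ReachesWithin N.toNTM.Step 2 (N.simCfg c) (N.simCfg d) := by
  obtain ⟨hrule, rest⟩ := h
  exact .head (step_simCfg_gapCfg hrule rest) (.single (step_gapCfg_simCfg _ _ rest))

/-- The configurations of the simulating Turing machine that it can reach on input `x`. -/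
inductive SimReachable (N : StackMachine A) (x : List A) : N.toNTM.Cfg → Prop
  | run {n : ℕ} {c : N.Cfg} (h : ReachesWithin N.Step n (N.init x) c) :
      SimReachable N x (N.simCfg c)
  | push {n : ℕ} {q : N.State} {p : Fin (N.extraStacks + 1) → Option N.Work}
      {rest : Fin (N.extraStacks + 1) → List (A ⊕ N.Work)}
      (h : ReachesWithin N.Step n (N.init x) ⟨q, fun i => pushed (p i) (rest i)⟩) :
      SimReachable N x (N.gapCfg q p rest)
  | done {n : ℕ} (h : N.AcceptsWithin x n)
      (T : Fin (N.extraStacks + 1) → Tape (Option (A ⊕ N.Work))) :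
      SimReachable N x ⟨.done, T⟩

theorem exists_eq_append_of_head {Λ : Type*} {pop : Option Λ} {l : List Λ}
    (h : ∀ s ∈ pop, (stackTape l).head = some s) : ∃ rest, l = pop.toList ++ rest := by
  cases pop with
  | none => exact ⟨l, rfl⟩
  | some s =>
    obtain ⟨rest, rfl⟩ := List.head?_eq_some_iff.1 ((head_stackTape l).symm.trans (h s rfl))
    exact ⟨rest, rfl⟩

theorem SimReachable.step {x : List A} {c d : N.toNTM.Cfg} (hc : SimReachable N x c)
    (hstep : N.toNTM.Step c d) : SimReachable N x d := by
  obtain ⟨t, ht, hstate, htape⟩ := hstep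
  obtain ⟨_, _⟩ := d
  obtain rfl : _ = t.1 := hstate
  obtain rfl : _ = _ := htape
  cases hc with
  | @run n c h =>
    obtain ⟨q, l⟩ := c
    change N.SimTrans (.run q) (fun i => (stackTape (l i)).head) t at ht
    cases ht with
    | pop hrule hpop =>
      choose rest hrest using fun i => exists_eq_append_of_head (hpop i)
      obtain rfl := funext hrest
      convert SimReachable.push (h.trans (.single (.intro hrule rest))) using 1
      exact congrArg (NTM.Cfg.mk _) (funext fun i => act_popAct _ _)
    | accept hempty =>
      have hstack : ∀ i, N.emptied i → l i = [] := fun i hi =>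
        List.head?_eq_none_iff.1 ((head_stackTape _).symm.trans (hempty i hi))
      exact .done ⟨_, h, rfl, hstack⟩ _
  | push h =>
    cases ht
    convert SimReachable.run h using 1
    exact congrArg (NTM.Cfg.mk _) (funext fun i => act_pushAct _ _)
  | done h T => cases ht

theorem SimReachable.reaches {x : List A} {n : ℕ} {c d : N.toNTM.Cfg}
    (h : N.toNTM.Reaches n c d) (hc : SimReachable N x c) : SimReachable N x d := by
  induction h with
  | refl => exact hc
  | step hstep _ ih => exact ih (hc.step hstep)

theorem exists_acceptsWithin_of_acceptsIn {x : List A} {n : ℕ} (h : N.toNTM.AcceptsIn x n) :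
    ∃ m, N.AcceptsWithin x m := by
  obtain ⟨c, hreach, hdone⟩ := h
  have hc : SimReachable N x c := by
    rw [toNTM_init] at hreach
    exact (SimReachable.run (.refl 0 _)).reaches hreach
  cases hc with
  | run | push => cases hdone
  | done h => exact ⟨_, h⟩

theorem AcceptsWithin.exists_acceptsIn {x : List A} {n : ℕ} (h : N.AcceptsWithin x n) :
    ∃ m ≤ 2 * n + 1, N.toNTM.AcceptsIn x m := by
  obtain ⟨⟨q, l⟩, hreach, rfl, hempty⟩ := h
  have hstep : N.toNTM.Step (N.simCfg ⟨N.accept, l⟩) ⟨.done, fun i => stackTape (l i)⟩ := by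
    refine ⟨_, SimTrans.accept fun i hi => ?_, rfl, funext fun i => (Tape.write_self _).symm⟩
    exact (head_stackTape _).trans (List.head?_eq_none_iff.2 (hempty i hi))
  obtain ⟨m, hm, hreach⟩ :=
    ((hreach.lift fun _ _ => Step.reachesWithin_simCfg).trans (.single hstep)).exists_reaches
  exact ⟨m, hm, _, by rwa [toNTM_init], rfl⟩

theorem inNP [Finite A] (N : StackMachine A) {L : Language A} (p : Polynomial ℕ)
    (hsound : ∀ x n, N.AcceptsWithin x n → x ∈ L)
    (hcomplete : ∀ x ∈ L, N.AcceptsWithin x (p.eval x.length)) : InNP L := by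
  refine ⟨N.toNTM, 2 * p + 1, fun x n h => ?_, fun x hx => ?_⟩
  · obtain ⟨m, hm⟩ := exists_acceptsWithin_of_acceptsIn h
    exact hsound x m hm
  · simpa using (hcomplete x hx).exists_acceptsIn

end StackMachine

end StackMachines

section FactorMachine

/-- The element `a` has a factorization `y * b * z`, where `y` may differ from `1` only if `P`
holds, and `z` only if `Q` holds. This covers the `L`-order (with `P` true and `Q` false) and the
`R`-order (with `P` false and `Q` true). -/
def FactorOrder {M : Type*} [Monoid M] (P Q : Prop) (a b : M) : Prop :=
  ∃ y z, (P ∨ y = 1) ∧ (Q ∨ z = 1) ∧ y * b * z = a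

variable {A M : Type*} {Γ : Type} [Monoid M] {P Q : Prop} {f : A → M} {γ : Γ → M}

/-- The phases of the machine for `FactorOrder`: reading `u`, rewriting, and comparing with `v`. -/
inductive Phase : Type
  | read
  | rewrite
  | compare

instance : Finite Phase :=
  Finite.of_surjective ![Phase.read, Phase.rewrite, Phase.compare] fun
    | .read => ⟨0, rfl⟩
    | .rewrite => ⟨1, rfl⟩
    | .compare => ⟨2, rfl⟩

/-- The rules of the machine for `FactorOrder`. The input `u # v` is on stack `0`, and the work
symbol `g` stands for the element `γ g` of `M`; stacks `1` and `2` hold the two parts of a cursor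
word. The machine reads `u`, rewrites the word at the cursor without changing its product, and then
checks that the part behind the cursor starts with `v`. -/
inductive FactorRule (f : A → M) (γ : Γ → M) : Phase → (Fin 3 → Option (Option A ⊕ Γ)) →
    Phase → (Fin 3 → Option Γ) → Prop
  | read {a : A} {g : Γ} (h : γ g = f a) :
      FactorRule f γ .read ![some (.inl (some a)), none, none] .read ![none, some g, none]
  | separator :
      FactorRule f γ .read ![some (.inl none), none, none] .rewrite ![none, none, none]
  | rewrite {l r l' r' : Option Γ}
      (h : l.elim 1 γ * r.elim 1 γ = l'.elim 1 γ * r'.elim 1 γ) :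
      FactorRule f γ .rewrite ![none, l.map .inr, r.map .inr] .rewrite ![none, l', r']
  | turn : FactorRule f γ .rewrite ![none, none, none] .compare ![none, none, none]
  | compare {a : A} {g : Γ} (h : γ g = f a) :
      FactorRule f γ .compare ![some (.inl (some a)), none, some (.inr g)] .compare
        ![none, none, none]

/-- The machine for `FactorOrder P Q`. -/
abbrev factorMachine [Finite Γ] (P Q : Prop) (f : A → M) (γ : Γ → M) :
    StackMachine (Option A) where
  extraStacks := 2
  Work := Γ
  finiteWork := inferInstance
  State := Phase
  finiteState := inferInstance
  start := .read
  accept := .compare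
  emptied := ![True, ¬P, ¬Q]
  rule := FactorRule f γ

section Soundness

/-- The product of the elements that the symbols on a stack stand for, from the top. -/
def rightValue (γ : Γ → M) (s : List (Option A ⊕ Γ)) : M :=
  (s.map (Sum.elim (fun _ => 1) γ)).prod

/-- The product of the elements that the symbols on a stack stand for, from the bottom. -/
def leftValue (γ : Γ → M) (s : List (Option A ⊕ Γ)) : M :=
  (s.map (Sum.elim (fun _ => 1) γ)).reverse.prod

theorem rightValue_pushed (p : Option Γ) (rest : List (Option A ⊕ Γ)) :
    rightValue γ (StackMachine.pushed p rest) = p.elim 1 γ * rightValue γ rest := by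
  cases p <;> simp [StackMachine.pushed, rightValue]

theorem leftValue_pushed (p : Option Γ) (rest : List (Option A ⊕ Γ)) :
    leftValue γ (StackMachine.pushed p rest) = leftValue γ rest * p.elim 1 γ := by
  cases p <;> simp [StackMachine.pushed, leftValue]

/-- The invariant of the computations on the input `x`: the parts of `u` and of `v` read so far and
the stacks `1` and `2` satisfy `left * v * right = u` in the monoid. -/
def FactorInvariant (f : A → M) (γ : Γ → M) (x : List (Option A)) :
    Phase → (Fin 3 → List (Option A ⊕ Γ)) → Prop
  | .read, s => ∃ (u : List A) (rest : List (Option A)), x = u.map some ++ rest ∧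
      s 0 = rest.map .inl ∧ s 2 = [] ∧ leftValue γ (s 1) = (u.map f).prod
  | .rewrite, s => ∃ (u : List A) (rest : List (Option A)), x = u.map some ++ none :: rest ∧
      s 0 = rest.map .inl ∧ leftValue γ (s 1) * rightValue γ (s 2) = (u.map f).prod
  | .compare, s => ∃ (u v : List A) (rest : List (Option A)),
      x = u.map some ++ none :: (v.map some ++ rest) ∧ s 0 = rest.map .inl ∧
      leftValue γ (s 1) * (v.map f).prod * rightValue γ (s 2) = (u.map f).prod

theorem exists_of_cons_eq_map_inl {α β : Type*} {b : α} {s : List (α ⊕ β)} {l : List α}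
    (h : .inl b :: s = l.map .inl) : ∃ t, l = b :: t ∧ s = t.map .inl := by
  obtain ⟨_, t, rfl, hb, ht⟩ := List.map_eq_cons_iff.1 h.symm
  exact ⟨t, congrArg (· :: t) (Sum.inl_injective hb), ht.symm⟩

theorem FactorInvariant.step {x : List (Option A)} {q q' : Phase}
    {pop : Fin 3 → Option (Option A ⊕ Γ)} {push : Fin 3 → Option Γ}
    {rest : Fin 3 → List (Option A ⊕ Γ)}
    (hinv : FactorInvariant f γ x q fun i => (pop i).toList ++ rest i)
    (hrule : FactorRule f γ q pop q' push) :
    FactorInvariant f γ x q' fun i => StackMachine.pushed (push i) (rest i) := by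
  cases hrule with
  | @read a g h =>
    obtain ⟨u, _, rfl, hinput, hright, hvalue⟩ := hinv
    obtain ⟨t, rfl, ht⟩ := exists_of_cons_eq_map_inl hinput
    refine ⟨u ++ [a], t, by simp, ht, hright, ?_⟩
    rw [leftValue_pushed, List.map_append, List.prod_append, ← hvalue, List.map_singleton,
      List.prod_singleton, ← h]
    rfl
  | separator =>
    obtain ⟨u, _, rfl, hinput, hright, hvalue⟩ := hinv
    obtain ⟨t, rfl, ht⟩ := exists_of_cons_eq_map_inl hinput
    refine ⟨u, t, rfl, ht, ?_⟩
    change leftValue γ (rest 1) * rightValue γ (rest 2) = _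
    rw [show rest 2 = [] from hright, ← hvalue]
    exact mul_one _
  | @rewrite l r l' r' h =>
    obtain ⟨u, t, rfl, hinput, hvalue⟩ := hinv
    refine ⟨u, t, rfl, hinput, Eq.trans ?_ hvalue⟩
    change leftValue γ (StackMachine.pushed l' _) * rightValue γ (StackMachine.pushed r' _) =
      leftValue γ (StackMachine.pushed l _) * rightValue γ (StackMachine.pushed r _)
    simp only [leftValue_pushed, rightValue_pushed, mul_assoc]
    rw [← mul_assoc (l'.elim 1 γ), ← h, mul_assoc]
  | turn =>
    obtain ⟨u, t, rfl, hinput, hvalue⟩ := hinv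
    refine ⟨u, [], t, rfl, hinput, ?_⟩
    rwa [List.map_nil, List.prod_nil, mul_one]
  | @compare a g h =>
    obtain ⟨u, v, _, rfl, hinput, hvalue⟩ := hinv
    obtain ⟨t, rfl, ht⟩ := exists_of_cons_eq_map_inl hinput
    refine ⟨u, v ++ [a], t, by simp, ht, Eq.trans ?_ hvalue⟩
    change leftValue γ (rest 1) * _ * rightValue γ (rest 2) =
      leftValue γ (rest 1) * _ * rightValue γ (StackMachine.pushed (some g) (rest 2))
    simp only [rightValue_pushed, Option.elim_some, h, List.map_append, List.prod_append,
      List.map_singleton, List.prod_singleton, mul_assoc]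

theorem FactorInvariant.of_reachesWithin [Finite Γ] {x : List (Option A)} {n : ℕ}
    {c d : (factorMachine P Q f γ).Cfg} (hc : FactorInvariant f γ x c.state c.stack)
    (h : ReachesWithin (factorMachine P Q f γ).Step n c d) :
    FactorInvariant f γ x d.state d.stack := by
  induction h with
  | refl => exact hc
  | head hstep _ ih =>
    obtain ⟨hrule, rest⟩ := hstep
    exact ih (hc.step hrule)

theorem mem_relLanguage_of_acceptsWithin [Finite Γ] {x : List (Option A)} {n : ℕ}
    (h : (factorMachine P Q f γ).AcceptsWithin x n) : x ∈ relLanguage f (FactorOrder P Q) := by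
  obtain ⟨⟨_, s⟩, hreach, rfl, hempty⟩ := h
  have hinit : FactorInvariant f γ x .read ((factorMachine P Q f γ).init x).stack :=
    ⟨[], x, rfl, rfl, rfl, rfl⟩
  obtain ⟨u, v, rest, rfl, hinput, hvalue⟩ := FactorInvariant.of_reachesWithin hinit hreach
  obtain rfl : rest = [] := List.map_eq_nil_iff.1 (hinput.symm.trans (hempty 0 trivial))
  refine ⟨u, v, by rw [List.append_nil], leftValue γ (s 1), rightValue γ (s 2), ?_, ?_, hvalue⟩
  · exact or_iff_not_imp_left.2 fun hP => congrArg (leftValue γ) (hempty 1 hP)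
  · exact or_iff_not_imp_left.2 fun hQ => congrArg (rightValue γ) (hempty 2 hQ)

end Soundness

section Completeness

variable [Finite Γ] {σ : M → Γ} {B : Set M}

/-- The configuration of the machine for `FactorOrder` that holds the unread `input` and a cursor
word, each letter `m` of which is represented by the symbol `σ m`. -/
def factorCfg (P Q : Prop) (f : A → M) (γ : Γ → M) (σ : M → Γ) (q : Phase) (input : List (Option A))
    (w : CursorWord M) : (factorMachine P Q f γ).Cfg :=
  ⟨q, ![input.map .inl, w.1.map (.inr ∘ σ), w.2.map (.inr ∘ σ)]⟩

theorem factorMachine_init (x : List (Option A)) :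
    (factorMachine P Q f γ).init x = factorCfg P Q f γ σ .read x ([], []) := by
  refine congrArg (StackMachine.Cfg.mk _) (funext fun i => ?_)
  fin_cases i <;> rfl

theorem FactorRule.step_factorCfg {q q' : Phase} {i : Option (Option A)} {l r l' r' : Option M}
    (h : FactorRule f γ q ![i.map .inl, l.map (.inr ∘ σ), r.map (.inr ∘ σ)] q'
      ![none, l'.map σ, r'.map σ]) (input : List (Option A)) (L R : List M) :
    (factorMachine P Q f γ).Step
      (factorCfg P Q f γ σ q (i.toList ++ input) (l.toList ++ L, r.toList ++ R))
      (factorCfg P Q f γ σ q' input (l'.toList ++ L, r'.toList ++ R)) := by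
  convert StackMachine.Step.intro (N := factorMachine P Q f γ) h
    ![input.map .inl, L.map (.inr ∘ σ), R.map (.inr ∘ σ)] using 1
  · refine congrArg (StackMachine.Cfg.mk _) (funext fun j => ?_)
    fin_cases j
    exacts [by cases i <;> rfl, by cases l <;> rfl, by cases r <;> rfl]
  · refine congrArg (StackMachine.Cfg.mk _) (funext fun j => ?_)
    fin_cases j
    exacts [rfl, by cases l' <;> rfl, by cases r' <;> rfl]

theorem reachesWithin_read (hσ : ∀ m ∈ B, γ (σ m) = m) (hf : Set.range f ⊆ B) (u : List A)
    (input : List (Option A)) (L R : List M) :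
    ReachesWithin (factorMachine P Q f γ).Step u.length
      (factorCfg P Q f γ σ .read (u.map some ++ input) (L, R))
      (factorCfg P Q f γ σ .read input ((u.map f).reverse ++ L, R)) := by
  induction u generalizing L with
  | nil => exact .refl 0 _
  | cons a u ih =>
    simp only [List.map_cons, List.reverse_cons, List.append_assoc]
    exact .head ((FactorRule.read (hσ _ (hf ⟨a, rfl⟩))).step_factorCfg (i := some (some a))
      (l := none) (r := none) (l' := some (f a)) (r' := none) _ L R) (ih _)

theorem reachesWithin_compare (hσ : ∀ m ∈ B, γ (σ m) = m) (hf : Set.range f ⊆ B) (v : List A)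
    (L R : List M) :
    ReachesWithin (factorMachine P Q f γ).Step v.length
      (factorCfg P Q f γ σ .compare (v.map some) (L, v.map f ++ R))
      (factorCfg P Q f γ σ .compare [] (L, R)) := by
  induction v with
  | nil => exact .refl 0 _
  | cons a v ih =>
    exact .head ((FactorRule.compare (hσ _ (hf ⟨a, rfl⟩))).step_factorCfg (i := some (some a))
      (l := none) (r := some (f a)) (l' := none) (r' := none) _ L _) ih

/-- Two cursor words differ, if at all, only in the letters next to the cursor, at most one on each
side, which lie in `B` and have the same product in both words. -/
inductive TopMove (B : Set M) : CursorWord M → CursorWord M → Prop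
  | intro {l r l' r' : Option M} (hl : ∀ m ∈ l, m ∈ B) (hr : ∀ m ∈ r, m ∈ B)
      (hl' : ∀ m ∈ l', m ∈ B) (hr' : ∀ m ∈ r', m ∈ B)
      (h : l.elim 1 id * r.elim 1 id = l'.elim 1 id * r'.elim 1 id) (L R : List M) :
      TopMove B (l.toList ++ L, r.toList ++ R) (l'.toList ++ L, r'.toList ++ R)

theorem TopMove.symm {c d : CursorWord M} (h : TopMove B c d) : TopMove B d c := by
  obtain ⟨hl, hr, hl', hr', h, L, R⟩ := h
  exact .intro hl' hr' hl hr h.symm L R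

theorem BasicMove.topMove {c d : CursorWord M} (h : BasicMove B c d) : TopMove B c d := by
  cases h with
  | @shift x L R hx =>
    exact .intro (l := some x) (r := none) (l' := none) (r' := some x)
      (by simpa) (by simp) (by simp) (by simpa) (by simp) L R
  | @merge x y L R hx hy hxy =>
    exact .intro (l := some x) (r := some y) (l' := none) (r' := some (x * y))
      (by simpa) (by simpa) (by simp) (by simpa) (by simp) L R
  | erase L R h =>
    exact .intro (l := none) (r := some 1) (l' := none) (r' := none)
      (by simp) (by simpa) (by simp) (by simp) (by simp) L R

theorem Move.step_factorCfg (hσ : ∀ m ∈ B, γ (σ m) = m) {c d : CursorWord M} (h : Move B c d)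
    (input : List (Option A)) :
    (factorMachine P Q f γ).Step (factorCfg P Q f γ σ .rewrite input c)
      (factorCfg P Q f γ σ .rewrite input d) := by
  have htop : TopMove B c d := h.elim BasicMove.topMove fun h => h.topMove.symm
  obtain @⟨l, r, l', r', hl, hr, hl', hr', hprod, L, R⟩ := htop
  have helim {o : Option M} (ho : ∀ m ∈ o, m ∈ B) : (o.map σ).elim 1 γ = o.elim 1 id := by
    cases o with
    | none => rfl
    | some m => exact hσ m (ho m rfl)
  have hrule := FactorRule.rewrite (f := f) (γ := γ) (l := l.map σ) (r := r.map σ) (l' := l'.map σ)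
    (r' := r'.map σ) (by rw [helim hl, helim hr, helim hl', helim hr', hprod])
  rw [Option.map_map, Option.map_map] at hrule
  exact hrule.step_factorCfg (i := none) input L R

theorem acceptsWithin_of_reachesWithin (hσ : ∀ m ∈ B, γ (σ m) = m) (hf : Set.range f ⊆ B)
    {u v : List A} {w₁ w₂ : List M} {n : ℕ} (hP : P ∨ w₁ = []) (hQ : Q ∨ w₂ = [])
    (h : ReachesWithin (Move B) n ((u.map f).reverse, []) (w₁.reverse, v.map f ++ w₂)) :
    (factorMachine P Q f γ).AcceptsWithin (u.map some ++ none :: v.map some)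
      (u.length + (1 + (n + (1 + v.length)))) := by
  have hread := reachesWithin_read (P := P) (Q := Q) hσ hf u (none :: v.map some) [] []
  have hseparator := FactorRule.separator.step_factorCfg (P := P) (Q := Q) (f := f) (γ := γ)
    (σ := σ) (i := some none) (l := none) (r := none) (l' := none) (r' := none) (v.map some)
    (u.map f).reverse []
  have hrewrite := h.lift (f := factorCfg P Q f γ σ .rewrite (v.map some))
    fun _ _ hmove => .single (hmove.step_factorCfg hσ _)
  have hturn := FactorRule.turn.step_factorCfg (P := P) (Q := Q) (f := f) (γ := γ) (σ := σ)
    (i := none) (l := none) (r := none) (l' := none) (r' := none) (v.map some)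
    w₁.reverse (v.map f ++ w₂)
  have hcompare := reachesWithin_compare (P := P) (Q := Q) hσ hf v w₁.reverse w₂
  rw [one_mul] at hrewrite
  rw [List.append_nil] at hread
  refine ⟨factorCfg P Q f γ σ .compare [] (w₁.reverse, w₂), ?_, rfl, ?_⟩
  · rw [factorMachine_init]
    exact hread.trans
      (.trans (.single hseparator) (hrewrite.trans (.trans (.single hturn) hcompare)))
  · intro i hi
    fin_cases i
    exacts [rfl, by simp [factorCfg, hP.resolve_left hi], by simp [factorCfg, hQ.resolve_left hi]]

end Completeness

theorem exists_finite_encoding {B : Set M} (hB : B.Finite) :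
    ∃ (Γ : Type) (_ : Finite Γ) (γ : Γ → M) (σ : M → Γ), ∀ m ∈ B, γ (σ m) = m := by
  obtain ⟨n, γ, -, hγ⟩ := (hB.insert 1).fin_param
  have : Nonempty (Fin n) := Set.range_nonempty_iff_nonempty.1 (hγ ▸ Set.insert_nonempty 1 B)
  refine ⟨Fin n, inferInstance, γ, Function.invFun γ, fun m hm => Function.invFun_eq ?_⟩
  exact hγ.ge (Set.mem_insert_of_mem 1 hm)

theorem LinearDivision.exists_words_of_factorOrder {S : Finset M} {C : ℕ} (hC : LinearDivision S C)
    (hPQ : ¬(P ∧ Q)) {a b : M} {m n : ℕ} (ha : a ∈ wordBall S m) (hb : b ∈ wordBall S n)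
    (h : FactorOrder P Q a b) :
    ∃ w₁ w₂ : List M, (∀ s ∈ w₁ ++ w₂, s ∈ S) ∧ (P ∨ w₁ = []) ∧ (Q ∨ w₂ = []) ∧
      (w₁ ++ w₂).length ≤ C * (n + m + 2) ∧ w₁.prod * b * w₂.prod = a := by
  obtain ⟨y, z, hy, hz, rfl⟩ := h
  by_cases hP : P
  · obtain rfl := hz.resolve_left fun hQ => hPQ ⟨hP, hQ⟩
    rw [mul_one] at ha ⊢
    obtain ⟨w, hw, hlen, rfl⟩ := (hC y b n m ha).1 hb
    exact ⟨w, [], by simpa, .inl hP, .inr rfl, by simpa, by simp⟩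
  obtain rfl := hy.resolve_left hP
  rw [one_mul] at ha ⊢
  by_cases hQ : Q
  · obtain ⟨w, hw, hlen, rfl⟩ := (hC b z n m ha).2 hb
    exact ⟨[], w, by simpa, .inr rfl, .inl hQ, by simpa, by simp⟩
  · obtain rfl := hz.resolve_left hQ
    exact ⟨[], [], by simp, .inr rfl, .inr rfl, by simp, by simp⟩

theorem LinearDivision.exists_linear_words_of_factorOrder {S : Finset M} {C : ℕ}
    (hC : LinearDivision S C) (hPQ : ¬(P ∧ Q)) {k : ℕ} (hf : Set.range f ⊆ wordBall S k)
    {u v : List A} (h : FactorOrder P Q (u.map f).prod (v.map f).prod) :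
    ∃ w₁ w₂ : List M, (∀ s ∈ w₁ ++ w₂, s ∈ S) ∧ (P ∨ w₁ = []) ∧ (Q ∨ w₂ = []) ∧
      (w₁ ++ w₂).length ≤ C * (k + 2) * (u.length + v.length + 1) ∧
      w₁.prod * (v.map f).prod * w₂.prod = (u.map f).prod := by
  have mem_wordBall (w : List A) : (w.map f).prod ∈ wordBall S (k * w.length) := by
    rw [← List.length_map (f := f)]
    exact prod_mem_wordBall_mul (List.forall_mem_map.2 fun a _ => hf (Set.mem_range_self a))
  obtain ⟨w₁, w₂, hw, hP, hQ, hlen, hprod⟩ :=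
    hC.exists_words_of_factorOrder hPQ (mem_wordBall u) (mem_wordBall v) h
  refine ⟨w₁, w₂, hw, hP, hQ, hlen.trans ?_, hprod⟩
  rw [mul_assoc]
  gcongr
  linarith

theorem inNP_factorOrder [Finite A] {S : Finset M} {C : ℕ} (hS : Generates S)
    (hiso : QuadraticIsoperimetry M) (hC : LinearDivision S C) (hPQ : ¬(P ∧ Q)) (f : A → M) :
    InNP (relLanguage f (FactorOrder P Q)) := by
  obtain ⟨k, hk⟩ := exists_subset_wordBall hS (Set.finite_range f)
  obtain ⟨B, hB, hXB, c, hc⟩ := hiso (S ∪ Set.range f) (S.finite_toSet.union (Set.finite_range f))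
  obtain ⟨Γ, _, γ, σ, hσ⟩ := exists_finite_encoding hB
  refine (factorMachine P Q f γ).inNP
    (.C (c * (C * (k + 2) + 1) ^ 2) * .X ^ 2 + .X + 1)
    (fun x n => mem_relLanguage_of_acceptsWithin) ?_
  rintro _ ⟨u, v, rfl, huv⟩
  obtain ⟨w₁, w₂, hw, hP, hQ, hlen, hprod⟩ := hC.exists_linear_words_of_factorOrder hPQ hk huv
  have mem_range (w : List A) : ∀ m ∈ w.map f, m ∈ Set.range f :=
    List.forall_mem_map.2 fun a _ => Set.mem_range_self a
  have hmoves := hc (u.map f) [] w₁ (v.map f ++ w₂)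
    (by
      rw [List.append_nil]
      exact fun m hm => .inr (mem_range u m hm))
    (by
      simp only [List.forall_mem_append] at hw ⊢
      exact ⟨fun m hm => .inl (hw.1 m hm), fun m hm => .inr (mem_range v m hm),
        fun m hm => .inl (hw.2 m hm)⟩)
    (by simp only [List.append_nil, List.prod_append, ← mul_assoc, hprod])
  have haccepts :=
    acceptsWithin_of_reachesWithin hσ (Set.subset_union_right.trans hXB) hP hQ hmoves
  refine haccepts.mono ?_
  have hwords : (u.map f ++ []).length + (w₁ ++ (v.map f ++ w₂)).length + 1 ≤
      (C * (k + 2) + 1) * (u.length + v.length + 1) := by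
    simp only [List.length_append, List.length_map, List.length_nil] at hlen ⊢
    linarith
  have hsquare := Nat.mul_le_mul_left c (Nat.pow_le_pow_left hwords 2)
  simp only [Polynomial.eval_add, Polynomial.eval_mul, Polynomial.eval_C, Polynomial.eval_pow,
    Polynomial.eval_X, Polynomial.eval_one, List.length_append, List.length_cons,
    List.length_map] at hsquare ⊢
  linarith

theorem lOrder_iff_factorOrder {a b : M} : LOrder a b ↔ FactorOrder True False a b := by
  constructor
  · intro h
    obtain ⟨y, hy⟩ := h ⟨1, one_mul a⟩
    exact ⟨y, 1, .inl trivial, .inr rfl, (mul_one _).trans hy⟩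
  · rintro ⟨y, z, -, hz, rfl⟩ _ ⟨m, rfl⟩
    obtain rfl := hz.resolve_left id
    exact ⟨m * y, by simp only [mul_one, mul_assoc]⟩

theorem rOrder_iff_factorOrder {a b : M} : ROrder a b ↔ FactorOrder False True a b := by
  constructor
  · intro h
    obtain ⟨z, hz⟩ := h ⟨1, mul_one a⟩
    exact ⟨1, z, .inr rfl, .inl trivial, (congrArg (· * z) (one_mul b)).trans hz⟩
  · rintro ⟨y, z, hy, -, rfl⟩ _ ⟨m, rfl⟩
    obtain rfl := hy.resolve_left id
    exact ⟨z * m, by simp only [one_mul, mul_assoc]⟩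

end FactorMachine

end HypMonoid

open HypMonoid in
theorem mainTheorem4_general {M : Type*} [Monoid M] [IsLeftCancelMul M]
    (hdeg : BoundedIndegree M) (hhyp : StronglyHyperbolic M) {A : Type*} [Finite A] (f : A → M) :
    InNP (relLanguage f (LOrder (M := M))) ∧ InNP (relLanguage f (ROrder (M := M))) := by
  obtain ⟨S, hS, δ, hδ⟩ := hhyp
  have hthin := hδ.thinWordTriangles
  obtain ⟨C, hC⟩ := hthin.exists_linearDivision hS hdeg
  have hiso := quadraticIsoperimetry hS hthin hC
  have hL : LOrder (M := M) = FactorOrder True False :=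
    funext₂ fun _ _ => propext lOrder_iff_factorOrder
  have hR : ROrder (M := M) = FactorOrder False True :=
    funext₂ fun _ _ => propext rOrder_iff_factorOrder
  rw [hL, hR]
  exact ⟨inNP_factorOrder hS hiso hC (fun h => h.2) f, inNP_factorOrder hS hiso hC (fun h => h.1) f⟩

theorem mainTheorem4 {M : Type*} [Monoid M] [IsLeftCancelMul M] (hfg : Monoid.FG M)
    (hdeg : HypMonoid.BoundedIndegree M) (hhyp : HypMonoid.StronglyHyperbolic M)
    {A : Type*} [Finite A] (f : A → M) (hf : Submonoid.closure (Set.range f) = ⊤) :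
    HypMonoid.InNP (HypMonoid.relLanguage f (HypMonoid.LOrder (M := M))) ∧
      HypMonoid.InNP (HypMonoid.relLanguage f (HypMonoid.ROrder (M := M))) :=
  mainTheorem4_general hdeg hhyp f
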